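/- Let $F$ be a real or complex Banach space with a finite-dimensional decomposition $(F_i)_{i\in\mathbb N}$, i.e. each $F_i$ is a finite-dimensional subspace of $F$ and every $x\in F$ can be written uniquely as a norm-convergent series $x=\sum_i f_i$ with $f_i\in F_i$. Let $E\subseteq F$ be a closed subspace with unit sphere $S_E$. "Interval" means a non-empty finite interval of $\mathbb N=\{0,1,2,\dots\}$; for such $I$ let $P_I(\sum_i f_i)=\sum_{i\in I}f_i$; we write $n<I$ for $n<\min I$, $I<n$ for $\max I<n$, and $I<J$ for $\max I<\min J$. We write $\Delta>0$ if $\Delta=(\delta_i)_{i\ge 0}$ is a decreasing sequence of strictly positive reals converging to $0$. For $\mathcal A\subseteq S_E^\infty=S_E^{\mathbb N}$ put $$\mathcal A_\Delta=\{(y_i)\in S_E^\infty : \exists (x_i)\in\mathcal A\ \forall i\ \|x_i-y_i\|<\delta_i\}.$$ For a strictly increasing sequence $(m_i)$ of natural numbers and $(x_i)\in S_E^\infty$, write $R_\Delta(m_i,x_i)$ if there are intervals $I_0<I_1<\cdots$ with $\|P_{I_i}(x_i)-x_i\|<\delta_i$ for all $i$, with $m_0<I_0$, and such that for every $i$ there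 is $j$ with $I_i<m_j<m_{j+1}<I_{i+1}$. In the $\Delta$-game, players I and II alternate: in round $k$ player I plays $n_k\in\mathbb N$ and then player II plays a pair $(x_k,I_k)$, where $x_k\in S_E$ and $I_k$ is an interval, subject to $\|x_k-P_{I_k}(x_k)\|<\delta_k$, $n_k<I_k$ and, for $k\ge 1$, $I_{k-1}<I_k$. II has a strategy to play into $\mathcal B\subseteq S_E^\infty$ if II has a strategy that always obeys these rules and guarantees $(x_k)_k\in\mathcal B$, whatever I plays. A $\Delta$-block tree is a non-empty set $T$ of finite sequences in $S_E$, closed under initial segments, such that for every $(x_0,\dots,x_{n-1})\in T$ the set $\{y\in S_E : (x_0,\dots,x_{n-1},y)\in T\}$ can be written as $\{y_i\}_{i=0}^\infty$, where for each $i$ there is an interval $I_i$ with $\|y_i-P_{I_i}(y_i)\|<\delta_n$, and $\min I_i\to\infty$ as $i\to\infty$. Let $[T]$ be the set of its infinite branches, i.e. of $(x_i)\in S_E^\infty$ all of whose finite initial segments are in $T$. **Theorem.** Let $\mathcal A\subseteq S_E^\infty$ be analytic (for the product of the norm topologies). Then the following are equivalent: (a) for every $\Delta>0$ and every strictly increasing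 sequence $(m_i)$ of natural numbers there is $(x_i)\in\mathcal A_\Delta$ with $R_\Delta(m_i,x_i)$; (b) for every $\Delta>0$, player II has a strategy in the $\Delta$-game to play into $\mathcal A_\Delta$; (c) for every $\Delta>0$ there is a $\Delta$-block tree $T$ with $[T]\subseteq\mathcal A_\Delta$. -/

import Mathlib

open Filter Topology

noncomputable section

namespace AsymptoticGame

variable {𝕜 F : Type*} [RCLike 𝕜] [NormedAddCommGroup F] [NormedSpace 𝕜 F]

/-- `V` is a finite-dimensional decomposition (F.D.D.) of `F`: the `V i` are finite-dimensional
subspaces and every `x` is uniquely a norm-convergent series `∑ f i` with `f i ∈ V i`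
(convergence of the ordered partial sums). -/
def IsFDD (V : ℕ → Submodule 𝕜 F) : Prop :=
  (∀ i, FiniteDimensional 𝕜 (V i)) ∧
    ∀ x : F, ∃! f : ℕ → F, (∀ i, f i ∈ V i) ∧
      Tendsto (fun n => ∑ i ∈ Finset.range n, f i) atTop (𝓝 x)

/-- The component of `x` in the `i`-th summand of the decomposition. -/
def IsFDD.coord {V : ℕ → Submodule 𝕜 F} (hV : IsFDD V) (x : F) (i : ℕ) : F :=
  (hV.2 x).exists.choose i

/-- The projection `P_I` of `F` onto the sum of the `V i`, `i ∈ I`, for a non-empty finite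
interval `I = {I.fst, …, I.snd}` of natural numbers. -/
def IsFDD.proj {V : ℕ → Submodule 𝕜 F} (hV : IsFDD V) (I : NonemptyInterval ℕ) (x : F) : F :=
  ∑ i ∈ Finset.Icc I.fst I.snd, hV.coord x i

/-- `Δ > 0`: the sequence `δ` consists of positive reals and decreases to `0`. -/
def DeltaPos (δ : ℕ → ℝ) : Prop :=
  (∀ i, 0 < δ i) ∧ Antitone δ ∧ Tendsto δ atTop (𝓝 0)

/-- The unit sphere of the subspace `E`. -/
abbrev UnitSphere (E : Submodule 𝕜 F) : Type _ := Metric.sphere (0 : E) 1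

variable {E : Submodule 𝕜 F} {V : ℕ → Submodule 𝕜 F}

/-- The infinite sequence `x` is a `Δ`-block, as witnessed by the intervals `I 0 < I 1 < ⋯`. -/
def IsBlockWith (hV : IsFDD V) (δ : ℕ → ℝ) (x : ℕ → UnitSphere E)
    (I : ℕ → NonemptyInterval ℕ) : Prop :=
  (∀ i, (I i).snd < (I (i + 1)).fst) ∧
    ∀ i, ‖hV.proj (I i) ((x i : E) : F) - ((x i : E) : F)‖ < δ i

/-- The relation `R(m, I)`: `m 0 < I 0` and for every `i` there is `j` with
`I i < m j < m (j + 1) < I (i + 1)`. -/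
def Rel (m : ℕ → ℕ) (I : ℕ → NonemptyInterval ℕ) : Prop :=
  m 0 < (I 0).fst ∧
    ∀ i, ∃ j, (I i).snd < m j ∧ m j < m (j + 1) ∧ m (j + 1) < (I (i + 1)).fst

/-- The relation `R_Δ(m, x)`: `x` is a `Δ`-block with a witness `I` satisfying `R(m, I)`. -/
def RelDelta (hV : IsFDD V) (δ : ℕ → ℝ) (m : ℕ → ℕ) (x : ℕ → UnitSphere E) : Prop :=
  ∃ I : ℕ → NonemptyInterval ℕ, IsBlockWith hV δ x I ∧ Rel m I

/-- The `Δ`-expansion `A_Δ` of a set `A` of sequences in the unit sphere. -/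
def expansion (A : Set (ℕ → UnitSphere E)) (δ : ℕ → ℝ) : Set (ℕ → UnitSphere E) :=
  {y | ∃ x ∈ A, ∀ i, ‖(x i : E) - (y i : E)‖ < δ i}

/-- A strategy for player II in the `Δ`-game, assigning to the moves `[n 0, …, n k]` made so far
by player I a pair `(x k, I k)`. (Its value at `[]` is never used.) -/
abbrev StrategyII (E : Submodule 𝕜 F) : Type _ := List ℕ → UnitSphere E × NonemptyInterval ℕ

/-- The answer of II, following `σ`, in round `k`, when I plays `n 0, n 1, …`. -/
def StrategyII.answer (σ : StrategyII E) (n : ℕ → ℕ) (k : ℕ) :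
    UnitSphere E × NonemptyInterval ℕ :=
  σ ((List.range (k + 1)).map n)

/-- `σ` is a strategy for II in the `Δ`-game to play into `B`: against every play
`n 0, n 1, …` of I, all answers `(x k, I k)` obey the rules `‖x k - P_{I k} (x k)‖ < δ k` and
`n k < I k < I (k + 1)`, and the sequence `x` belongs to `B`. -/
def StrategyII.PlaysInto (hV : IsFDD V) (δ : ℕ → ℝ) (σ : StrategyII E)
    (B : Set (ℕ → UnitSphere E)) : Prop :=
  ∀ n : ℕ → ℕ,
    (∀ k, ‖((σ.answer n k).1 : F) - hV.proj (σ.answer n k).2 ((σ.answer n k).1 : F)‖ < δ k) ∧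
    (∀ k, n k < (σ.answer n k).2.fst) ∧
    (∀ k, (σ.answer n k).2.snd < (σ.answer n (k + 1)).2.fst) ∧
    (fun k => (σ.answer n k).1) ∈ B

/-- `T` is a `Δ`-block tree of finite sequences in the unit sphere of `E`. -/
def IsBlockTree (hV : IsFDD V) (δ : ℕ → ℝ) (T : Set (List (UnitSphere E))) : Prop :=
  T.Nonempty ∧
  (∀ s ∈ T, ∀ t : List (UnitSphere E), t <+: s → t ∈ T) ∧
  ∀ s ∈ T, ∃ (y : ℕ → UnitSphere E) (I : ℕ → NonemptyInterval ℕ),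
    {z : UnitSphere E | s ++ [z] ∈ T} = Set.range y ∧
    (∀ i, ‖((y i : E) : F) - hV.proj (I i) ((y i : E) : F)‖ < δ s.length) ∧
    Tendsto (fun i => (I i).fst) atTop atTop

/-- The set `[T]` of infinite branches of `T`. -/
def branches (T : Set (List (UnitSphere E))) : Set (ℕ → UnitSphere E) :=
  {x | ∀ n, (List.range n).map x ∈ T}

end AsymptoticGame

end

/-!
A non-empty analytic set is a continuous image of the space of binary sequences with infinitely
many `true`s. If in the `Δ`-game player II must also reveal, one bit per round, a parameter whose
image is close to the vectors she plays, then she only has to produce infinitely many bits `true`: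
this is a Büchi condition, so one of the players wins by a positional strategy. A strategy of II is
what (b) asks for. If I had one, then, since blocks supported in `[0, N]` form a totally bounded
set, there would after discretisation be only finitely many positions to consider up to stage `N`,
and the answers of I would be dominated by a fast growing sequence `m`. But a sequence provided by
(a) for `m`, once discretised, is a play against this strategy in which II never breaks a rule.

Choosing for every finite sequence of answers of a strategy of II one history of moves of I that
leads to it gives a block tree, and a block tree has a branch whose blocks leave gaps as large as
(a) requires.
-/

namespace AsymptoticGame

section FixedPoints

open OrdinalApprox

universe u

variable {X : Type u} {Γ : Set X →o Set X} {p : X} {r : Ordinal.{u}}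

/-- The first stage of the transfinite iteration of `Γ` from below that puts `p` into the least
fixed point; a junk value for `p` outside the least fixed point. -/
noncomputable def lfpRank (Γ : Set X →o Set X) (p : X) : Ordinal.{u} :=
  sInf {r | p ∈ Γ (lfpApprox Γ ⊥ r)}

theorem mem_lfpApprox_iff_exists_lt :
    p ∈ lfpApprox Γ ⊥ r ↔ ∃ b < r, p ∈ Γ (lfpApprox Γ ⊥ b) := by
  rw [lfpApprox]
  simp

theorem lfpRank_le (h : p ∈ Γ (lfpApprox Γ ⊥ r)) : lfpRank Γ p ≤ r :=
  csInf_le' h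

theorem mem_apply_lfpApprox_lfpRank (hp : p ∈ Γ.lfp) : p ∈ Γ (lfpApprox Γ ⊥ (lfpRank Γ p)) := by
  obtain ⟨r, hr⟩ := lfp_mem_range_lfpApprox Γ
  obtain ⟨b, -, hb⟩ := mem_lfpApprox_iff_exists_lt.1 (hr.symm ▸ hp)
  exact csInf_mem (s := {r | p ∈ Γ (lfpApprox Γ ⊥ r)}) ⟨b, hb⟩

theorem mem_lfpApprox_iff_lfpRank_lt :
    p ∈ lfpApprox Γ ⊥ r ↔ p ∈ Γ.lfp ∧ lfpRank Γ p < r := by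
  constructor
  · intro h
    obtain ⟨b, hbr, hb⟩ := mem_lfpApprox_iff_exists_lt.1 h
    exact ⟨lfpApprox_le_of_mem_fixedPoints Γ Γ.map_lfp bot_le r h, (lfpRank_le hb).trans_lt hbr⟩
  · rintro ⟨hp, hr⟩
    exact mem_lfpApprox_iff_exists_lt.2 ⟨_, hr, mem_apply_lfpApprox_lfpRank hp⟩

theorem apply_lfpApprox_subset_lfp : Γ (lfpApprox Γ ⊥ r) ⊆ Γ.lfp := by
  conv_rhs => rw [← Γ.map_lfp]
  exact Γ.monotone (lfpApprox_le_of_mem_fixedPoints Γ Γ.map_lfp bot_le r)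

end FixedPoints

section WellFounded

variable {α : Type*} {u : ℕ → α}

theorem frequently_not_succ_lt [Preorder α] [WellFoundedLT α] (u : ℕ → α) :
    ∃ᶠ k in atTop, ¬ u (k + 1) < u k :=
  frequently_atTop.2 fun K =>
    let ⟨k, hk⟩ := WellFounded.not_rel_apply_succ (r := (· < ·)) fun k => u (K + k)
    ⟨K + k, Nat.le_add_right K k, hk⟩

theorem not_frequently_succ_lt_of_antitone [PartialOrder α] [WellFoundedLT α] (hu : Antitone u) :
    ¬ ∃ᶠ k in atTop, u (k + 1) < u k := by
  obtain ⟨K, hK⟩ := WellFoundedLT.antitone_chain_condition hu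
  rw [not_frequently]
  filter_upwards [eventually_ge_atTop K] with k hk
  rw [← hK k hk, ← hK (k + 1) (hk.trans k.le_succ)]
  exact lt_irrefl _

end WellFounded

/-- A Büchi game on the positions `X`: in each round player I plays in `N`, then player II plays
in `M`, which determines the next position. II wins if all her moves are legal and infinitely many
of them are good. -/
structure BuchiGame (X N M : Type*) where
  next : X → N → M → X
  legal : X → N → M → Prop
  good : X → N → M → Prop

namespace BuchiGame

variable {X N M : Type*} (G : BuchiGame X N M) {p₀ : X}

/-- The sequence of positions `p` arises from the moves `n` of I and `a` of II. -/
def IsRun (p : ℕ → X) (n : ℕ → N) (a : ℕ → M) : Prop :=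
  ∀ k, p (k + 1) = G.next (p k) (n k) (a k)

/-- `τ` is a positional winning strategy of player II from `p₀`. -/
def WinsII (p₀ : X) (τ : X → N → M) : Prop :=
  ∀ (p : ℕ → X) (n : ℕ → N), p 0 = p₀ → G.IsRun p n (fun k => τ (p k) (n k)) →
    (∀ k, G.legal (p k) (n k) (τ (p k) (n k))) ∧
      ∃ᶠ k in atTop, G.good (p k) (n k) (τ (p k) (n k))

/-- `φ` is a positional winning strategy of player I from `p₀`. -/
def WinsI (p₀ : X) (φ : X → N) : Prop :=
  ∀ (p : ℕ → X) (a : ℕ → M), p 0 = p₀ → G.IsRun p (fun k => φ (p k)) a →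
    (∀ k, G.legal (p k) (φ (p k)) (a k)) → ¬ ∃ᶠ k in atTop, G.good (p k) (φ (p k)) (a k)

/-- The one-round operator whose least fixed point is the set of positions from which II can force
a good move into `W`. -/
def attract (W : Set X) : Set X →o Set X where
  toFun Y := {p | ∀ n, ∃ a, G.legal p n a ∧ (G.good p n a ∧ G.next p n a ∈ W ∨ G.next p n a ∈ Y)}
  monotone' _ _ hYZ _ hp n := (hp n).imp fun _ => And.imp_right (Or.imp_right fun h => hYZ h)

theorem attract_mono {W W' : Set X} (h : W ⊆ W') : G.attract W ≤ G.attract W' :=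
  fun _ _ hp n =>
    (hp n).imp fun _ => And.imp_right (Or.imp_left (And.imp_right fun hW => h hW))

/-- `G.avoid L` consists of the positions from which I can prevent II from ever making a good move
that leads outside `L`. Its least fixed point is the winning region of I. -/
def avoid : Set X →o Set X where
  toFun L := (G.attract Lᶜ).lfpᶜ
  monotone' _ _ h :=
    Set.compl_subset_compl.2 (OrderHom.lfp.monotone (G.attract_mono (Set.compl_subset_compl.2 h)))

theorem exists_of_mem_avoid {L : Set X} {p : X} (hp : p ∈ G.avoid L) :
    ∃ n, ∀ a, G.legal p n a →
      G.next p n a ∈ G.avoid L ∧ (G.good p n a → G.next p n a ∈ L) := by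
  have hp' : p ∉ G.attract Lᶜ (G.attract Lᶜ).lfp := by rwa [OrderHom.map_lfp]
  simp only [attract, OrderHom.coe_mk, Set.mem_ofPred_eq, not_forall, not_exists, not_and,
    not_or, Set.mem_compl_iff, not_not] at hp'
  exact hp'.imp fun n hn a ha => ⟨(hn a ha).2, (hn a ha).1⟩

theorem exists_winsI (hp₀ : p₀ ∈ G.avoid.lfp) : ∃ φ, G.WinsI p₀ φ := by
  have hresponse : ∀ p ∈ G.avoid.lfp, ∃ n, ∀ a, G.legal p n a → G.next p n a ∈ G.avoid.lfp ∧
      lfpRank G.avoid (G.next p n a) ≤ lfpRank G.avoid p ∧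
      (G.good p n a → lfpRank G.avoid (G.next p n a) < lfpRank G.avoid p) := by
    intro p hp
    obtain ⟨n, hn⟩ := G.exists_of_mem_avoid (mem_apply_lfpApprox_lfpRank hp)
    exact ⟨n, fun a ha => ⟨apply_lfpApprox_subset_lfp (hn a ha).1, lfpRank_le (hn a ha).1,
      fun hgood => (mem_lfpApprox_iff_lfpRank_lt.1 ((hn a ha).2 hgood)).2⟩⟩
  have : Nonempty N := ⟨(hresponse p₀ hp₀).choose⟩
  choose! φ hφ using hresponse
  refine ⟨φ, fun p a h0 hrun hlegal hgood => ?_⟩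
  have hmem : ∀ k, p k ∈ G.avoid.lfp := by
    intro k
    induction k with
    | zero => rwa [h0]
    | succ k ih => exact hrun k ▸ (hφ _ ih _ (hlegal k)).1
  have hanti : Antitone fun k => lfpRank G.avoid (p k) :=
    antitone_nat_of_succ_le fun k => hrun k ▸ (hφ _ (hmem k) _ (hlegal k)).2.1
  exact not_frequently_succ_lt_of_antitone hanti
    (hgood.mono fun k hk => hrun k ▸ (hφ _ (hmem k) _ (hlegal k)).2.2 hk)

theorem lfp_attract_compl_lfp_avoid : (G.attract G.avoid.lfpᶜ).lfp = G.avoid.lfpᶜ :=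
  (compl_eq_comm.1 G.avoid.map_lfp).symm

theorem exists_winsII [Nonempty M] (hp₀ : p₀ ∉ G.avoid.lfp) : ∃ τ, G.WinsII p₀ τ := by
  set W := G.avoid.lfpᶜ with hW
  have hresponse : ∀ p n, p ∈ W → ∃ a, G.legal p n a ∧ G.next p n a ∈ W ∧
      (G.good p n a ∨ lfpRank (G.attract W) (G.next p n a) < lfpRank (G.attract W) p) := by
    intro p n hp
    rw [hW, ← lfp_attract_compl_lfp_avoid] at hp
    obtain ⟨a, ha, ⟨hgood, hmem⟩ | hmem⟩ := mem_apply_lfpApprox_lfpRank hp n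
    · exact ⟨a, ha, hmem, Or.inl hgood⟩
    · obtain ⟨hmem, hlt⟩ := mem_lfpApprox_iff_lfpRank_lt.1 hmem
      exact ⟨a, ha, G.lfp_attract_compl_lfp_avoid.le hmem, Or.inr hlt⟩
  choose! τ hτ using hresponse
  refine ⟨τ, fun p n h0 hrun => ?_⟩
  have hmem : ∀ k, p k ∈ W := by
    intro k
    induction k with
    | zero => rwa [h0]
    | succ k ih => exact hrun k ▸ (hτ _ (n k) ih).2.1
  refine ⟨fun k => (hτ _ (n k) (hmem k)).1, ?_⟩
  refine (frequently_not_succ_lt fun k => lfpRank (G.attract W) (p k)).mono fun k hk => ?_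
  exact (hτ _ (n k) (hmem k)).2.2.resolve_right (hrun k ▸ hk)

theorem determined [Nonempty M] (p₀ : X) : (∃ τ, G.WinsII p₀ τ) ∨ ∃ φ, G.WinsI p₀ φ :=
  (Classical.em (p₀ ∈ G.avoid.lfp)).symm.imp G.exists_winsII G.exists_winsI

end BuchiGame

section Parameters

/-- The binary sequences with infinitely many `true`s: a copy of the Baire space, by counting the
`false`s between consecutive `true`s. A player who reveals a parameter bit by bit always chooses
between two values only, and having infinitely many `true`s is a Büchi condition. -/
abbrev RecurrentBits : Type :=
  {c : ℕ → Bool // ∃ᶠ k in atTop, c k}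

namespace RecurrentBits

theorem infinite (c : RecurrentBits) : {k | c.1 k}.Infinite :=
  Nat.frequently_atTop_iff_infinite.1 c.2

theorem nth_eq_nth {c d : RecurrentBits} {i : ℕ}
    (h : ∀ k ≤ Nat.nth (fun k => c.1 k) i, d.1 k = c.1 k) :
    Nat.nth (fun k => d.1 k) i = Nat.nth (fun k => c.1 k) i := by
  set N := Nat.nth (fun k => c.1 k) i
  have hmem : d.1 N := (h N le_rfl).trans (Nat.nth_mem_of_infinite c.infinite i)
  have hcount : Nat.count (fun k => d.1 k) N = i := by
    rw [← Nat.count_nth_of_infinite c.infinite i]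
    simp only [Nat.count_eq_card_filter_range]
    congr 1
    exact Finset.filter_congr fun k hk => by rw [h k (Finset.mem_range.1 hk).le]
  have hnth := Nat.nth_count (p := fun k => d.1 k) hmem
  rwa [hcount] at hnth

theorem continuous_nth (i : ℕ) :
    Continuous fun c : RecurrentBits => Nat.nth (fun k => c.1 k) i := by
  refine continuous_iff_continuousAt.2 fun c => tendsto_nhds_of_eventually_eq ?_
  have hagree : ∀ᶠ d in 𝓝 c, ∀ k ∈ Set.Iic (Nat.nth (fun k => c.1 k) i), d.1 k = c.1 k := by
    refine (eventually_all_finite (Set.finite_Iic _)).2 fun k _ => ?_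
    have hk : Continuous fun d : RecurrentBits => d.1 k :=
      (continuous_apply k).comp continuous_subtype_val
    exact hk.continuousAt.eventually_mem ((isOpen_discrete {c.1 k}).mem_nhds rfl)
  exact hagree.mono fun d hd => nth_eq_nth hd

/-- The parameter in the Baire space coded by `c`: the lengths of the blocks of `false`s after the
first `true`. -/
noncomputable def toBaire (c : RecurrentBits) (i : ℕ) : ℕ :=
  Nat.nth (fun k => c.1 k) (i + 1) - Nat.nth (fun k => c.1 k) i - 1

theorem continuous_toBaire : Continuous toBaire :=
  continuous_pi fun i => by
    have := continuous_nth (i + 1)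
    have := continuous_nth i
    unfold toBaire
    fun_prop

theorem toBaire_surjective : Function.Surjective toBaire := by
  intro w
  let e : ℕ → ℕ := fun i => ∑ j ∈ Finset.range i, (w j + 1)
  have hsucc : ∀ i, e (i + 1) = e i + (w i + 1) := fun i => Finset.sum_range_succ _ i
  have he : StrictMono e := strictMono_nat_of_lt_succ fun i => by rw [hsucc]; omega
  classical
  let c : ℕ → Bool := fun k => decide (k ∈ Set.range e)
  have hc : ∀ k, c k ↔ k ∈ Set.range e := fun k => decide_eq_true_iff
  have hinf : {k | c k}.Infinite := by
    simp only [hc]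
    exact Set.infinite_range_of_injective he.injective
  have hnth : ∀ i, Nat.nth (fun k => c k) i = e i := by
    intro i
    rw [← Nat.nth_comp_of_strictMono he (fun k => (hc k).1) fun hfin => (hinf hfin).elim]
    simp [hc]
  refine ⟨⟨c, Nat.frequently_atTop_iff_infinite.2 hinf⟩, funext fun i => ?_⟩
  simp only [toBaire, hnth, hsucc]
  omega

end RecurrentBits

theorem exists_continuous_recurrentBits_range_eq {Y : Type*} [TopologicalSpace Y] {s : Set Y}
    (hs : MeasureTheory.AnalyticSet s) (hne : s.Nonempty) :
    ∃ f : RecurrentBits → Y, Continuous f ∧ Set.range f = s := by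
  rw [MeasureTheory.AnalyticSet] at hs
  obtain ⟨g, hg, rfl⟩ := hs.resolve_left hne.ne_empty
  exact ⟨g ∘ RecurrentBits.toBaire, hg.comp RecurrentBits.continuous_toBaire,
    RecurrentBits.toBaire_surjective.range_comp g⟩

end Parameters

theorem map_range_succ {α : Type*} (x : ℕ → α) (k : ℕ) :
    (List.range (k + 1)).map x = (List.range k).map x ++ [x k] := by
  simp [List.range_succ]

section Unfolding

variable {α N : Type*} (rule : List α → N → α → Prop) (K : ℕ → α → Set RecurrentBits)

/-- `σ` is a winning strategy of player II in the game with payoff set `B` in which I plays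
`n 0, n 1, …`, II answers `a 0, a 1, …`, and II must observe `rule (a 0, …, a (k - 1)) (n k) (a k)`
in each round `k`. The strategy computes `a k` from `[n 0, …, n k]`. -/
def IsWinningStrategy (B : Set (ℕ → α)) (σ : List N → α) : Prop :=
  ∀ (n : ℕ → N) (a : ℕ → α), (∀ k, a k = σ ((List.range (k + 1)).map n)) →
    (∀ k, rule ((List.range k).map a) (n k) (a k)) ∧ a ∈ B

/-- The moves and bits in the finite history `p` are compatible with the existence of a parameter
`c` such that `c ∈ K i (a i)` for every move `a i`. -/
def Compatible (p : List (α × Bool)) : Prop :=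
  ∃ c : RecurrentBits, ∀ i (hi : i < p.length), c.1 i = p[i].2 ∧ c ∈ K i p[i].1

/-- The unfolding of the game with payoff set `{a | (⋂ i, K i (a i)).Nonempty}`: with each move,
player II plays a bit of a parameter in `⋂ i, K i (a i)`. -/
def unfoldedGame : BuchiGame (List (α × Bool)) N (α × Bool) where
  next p _ b := p ++ [b]
  legal p n b := rule (p.map Prod.fst) n b.1 ∧ Compatible K (p ++ [b])
  good _ _ b := b.2

variable {rule K}

theorem IsWinningStrategy.mono {B C : Set (ℕ → α)} {σ : List N → α}
    (hσ : IsWinningStrategy rule B σ) (hBC : B ⊆ C) : IsWinningStrategy rule C σ :=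
  fun n a ha => (hσ n a ha).imp_right fun h => hBC h

theorem compatible_map_range {b : ℕ → α × Bool} {k : ℕ} :
    Compatible K ((List.range k).map b) ↔
      ∃ c : RecurrentBits, ∀ i < k, c.1 i = (b i).2 ∧ c ∈ K i (b i).1 := by
  simp [Compatible]

theorem mem_of_forall_compatible (hK : ∀ i a, IsClosed (K i a)) {b : ℕ → α × Bool}
    (hb : ∀ k, Compatible K ((List.range k).map b)) (hinf : ∃ᶠ k in atTop, (b k).2) :
    (⋂ i, K i (b i).1).Nonempty := by
  choose c hc using fun k => compatible_map_range.1 (hb k)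
  let d : RecurrentBits := ⟨fun i => (b i).2, hinf⟩
  have hlim : Tendsto c atTop (𝓝 d) := by
    refine tendsto_subtype_rng.2 (tendsto_pi_nhds.2 fun i => tendsto_nhds_of_eventually_eq ?_)
    filter_upwards [eventually_gt_atTop i] with k hk
    exact (hc k i hk).1
  refine ⟨d, Set.mem_iInter.2 fun i => (hK i _).mem_of_tendsto hlim ?_⟩
  filter_upwards [eventually_gt_atTop i] with k hk
  exact (hc k i hk).2

theorem exists_isWinningStrategy_of_winsII [Nonempty α] (hK : ∀ i a, IsClosed (K i a))
    {τ : List (α × Bool) → N → α × Bool} (hτ : (unfoldedGame rule K).WinsII [] τ) :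
    ∃ σ, IsWinningStrategy rule {a | (⋂ i, K i (a i)).Nonempty} σ := by
  let history : List N → List (α × Bool) := List.foldl (fun p n => p ++ [τ p n]) []
  refine ⟨fun l => ((history l).getLast?.map Prod.fst).getD (Classical.arbitrary α),
    fun n a ha => ?_⟩
  let p : ℕ → List (α × Bool) := fun k => history ((List.range k).map n)
  let b : ℕ → α × Bool := fun k => τ (p k) (n k)
  have hsucc : ∀ k, p (k + 1) = p k ++ [b k] := fun k => by
    simp only [p, b, history, map_range_succ, List.foldl_append, List.foldl_cons, List.foldl_nil]
  have hp : ∀ k, p k = (List.range k).map b := by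
    intro k
    induction k with
    | zero => rfl
    | succ k ih => rw [hsucc, map_range_succ, ih]
  obtain rfl : a = fun k => (b k).1 := by
    funext k
    rw [ha]
    change ((p (k + 1)).getLast?.map Prod.fst).getD _ = _
    simp [hsucc]
  obtain ⟨hlegal, hinf⟩ := hτ p n rfl hsucc
  refine ⟨fun k => ?_, mem_of_forall_compatible hK (fun k => ?_) hinf⟩
  · have hrule : rule ((p k).map Prod.fst) (n k) (b k).1 := (hlegal k).1
    rwa [hp, List.map_map] at hrule
  · have hcompatible : Compatible K (p k ++ [b k]) := (hlegal k).2
    rw [← hsucc, hp] at hcompatible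
    obtain ⟨c, hc⟩ := compatible_map_range.1 hcompatible
    exact compatible_map_range.2 ⟨c, fun i hi => hc i (hi.trans k.lt_succ_self)⟩

theorem exists_not_rule_of_winsI {φ : List (α × Bool) → N}
    (hφ : (unfoldedGame rule K).WinsI [] φ) {a : ℕ → α} {c : RecurrentBits}
    (hc : ∀ i, c ∈ K i (a i)) :
    ∃ k, ¬ rule ((List.range k).map a) (φ ((List.range k).map fun i => (a i, c.1 i))) (a k) := by
  by_contra! hrule
  let b : ℕ → α × Bool := fun i => (a i, c.1 i)
  refine hφ (fun k => (List.range k).map b) b rfl (map_range_succ b) (fun k => ⟨?_, ?_⟩) c.2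
  · simpa [b, Function.comp_def] using hrule k
  · exact map_range_succ b k ▸ compatible_map_range.2 ⟨c, fun i _ => ⟨rfl, hc i⟩⟩

end Unfolding

section Domination

theorem exists_strictMono_forall_le {X : Type*} {Q : ℕ → Set X} (hQ : ∀ N, (Q N).Finite)
    (φ : X → ℕ) (N₀ : ℕ) :
    ∃ m : ℕ → ℕ, StrictMono m ∧ N₀ ≤ m 0 ∧ ∀ j, ∀ p ∈ Q (m j), φ p ≤ m (j + 1) := by
  choose g hg using fun N => ((hQ N).image φ).bddAbove
  let m : ℕ → ℕ := fun j => (fun N => max (N + 1) (g N))^[j] N₀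
  have hm : ∀ j, m (j + 1) = max (m j + 1) (g (m j)) := fun j => Function.iterate_succ_apply' _ _ _
  refine ⟨m, strictMono_nat_of_lt_succ fun j => ?_, le_rfl, fun j p hp => ?_⟩
  · exact hm j ▸ (m j).lt_succ_self.trans_le (le_max_left _ _)
  · exact hm j ▸ (hg (m j) ⟨p, hp, rfl⟩).trans (le_max_right _ _)

theorem finite_lists_of_finite {α : Type*} {S : Set α} (hS : S.Finite) (N : ℕ) :
    {l : List α | l.length ≤ N ∧ ∀ x ∈ l, x ∈ S}.Finite := by
  have := hS.to_subtype
  refine ((List.finite_length_le S N).image (List.map Subtype.val)).subset ?_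
  rintro l ⟨hl, hlS⟩
  lift l to List S using hlS
  exact ⟨l, by simpa using hl, rfl⟩

theorem exists_isWinningStrategy_of_forall_strictMono {α : Type*} {rule : List α → ℕ → α → Prop}
    {K : ℕ → α → Set RecurrentBits} (hK : ∀ i a, IsClosed (K i a))
    {S : ℕ → Set α} (hS : ∀ N, (S N).Finite)
    (h : ∀ m : ℕ → ℕ, StrictMono m → ∃ a : ℕ → α, (⋂ i, K i (a i)).Nonempty ∧
      (∀ n ≤ m 0, rule [] n (a 0)) ∧
      ∀ k, ∃ j, k < m j ∧ (∀ i ≤ k, a i ∈ S (m j)) ∧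
        ∀ n ≤ m (j + 1), rule ((List.range (k + 1)).map a) n (a (k + 1))) :
    ∃ σ, IsWinningStrategy rule {a | (⋂ i, K i (a i)).Nonempty} σ := by
  have : Nonempty α := ⟨(h id strictMono_id).choose 0⟩
  obtain ⟨τ, hτ⟩ | ⟨φ, hφ⟩ := (unfoldedGame rule K).determined []
  · exact exists_isWinningStrategy_of_winsII hK hτ
  exfalso
  obtain ⟨m, hm, hm0, hmQ⟩ := exists_strictMono_forall_le
    (fun N => finite_lists_of_finite ((hS N).prod (Set.finite_univ (α := Bool))) N) φ (φ [])
  obtain ⟨a, ⟨c, hc⟩, hzero, hsucc⟩ := h m hm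
  obtain ⟨k, hk⟩ := exists_not_rule_of_winsI hφ (Set.mem_iInter.1 hc)
  refine hk ?_
  cases k with
  | zero => exact hzero _ hm0
  | succ k =>
    obtain ⟨j, hkj, haS, hrule⟩ := hsucc k
    refine hrule _ (hmQ j _ ⟨by simpa using hkj, ?_⟩)
    simpa [Nat.lt_succ_iff] using haS

end Domination

variable {𝕜 F : Type*} [RCLike 𝕜] [NormedAddCommGroup F] [NormedSpace 𝕜 F]
  {E : Submodule 𝕜 F} {V : ℕ → Submodule 𝕜 F}

section Trees

theorem exists_seq_of_forall_list {α : Type*} {Good : List α → Prop} {P : List α → α → Prop}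
    (hnil : Good []) (hstep : ∀ l, Good l → ∃ a, P l a ∧ Good (l ++ [a])) :
    ∃ a : ℕ → α, ∀ k, Good ((List.range k).map a) ∧ P ((List.range k).map a) (a k) := by
  have : Nonempty α := ⟨(hstep [] hnil).choose⟩
  choose! g hgP hgGood using hstep
  let l : ℕ → List α := fun k => (fun l => l ++ [g l])^[k] []
  have hsucc : ∀ k, l (k + 1) = l k ++ [g (l k)] := fun k => Function.iterate_succ_apply' _ _ _
  have hl : ∀ k, l k = (List.range k).map fun i => g (l i) := by
    intro k
    induction k with
    | zero => rfl
    | succ k ih => rw [hsucc, map_range_succ, ← ih]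
  have hGood : ∀ k, Good (l k) := by
    intro k
    induction k with
    | zero => exact hnil
    | succ k ih => exact hsucc k ▸ hgGood _ ih
  exact ⟨fun k => g (l k), fun k => hl k ▸ ⟨hGood k, hgP _ (hGood k)⟩⟩

theorem IsBlockTree.nil_mem {hV : IsFDD V} {δ : ℕ → ℝ} {T : Set (List (UnitSphere E))}
    (hT : IsBlockTree hV δ T) : [] ∈ T :=
  hT.1.elim fun s hs => hT.2.1 s hs [] List.nil_prefix

theorem IsBlockTree.exists_child {hV : IsFDD V} {δ : ℕ → ℝ} {T : Set (List (UnitSphere E))}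
    (hT : IsBlockTree hV δ T) {s : List (UnitSphere E)} (hs : s ∈ T) (N : ℕ) :
    ∃ (z : UnitSphere E) (I : NonemptyInterval ℕ), s ++ [z] ∈ T ∧
      ‖hV.proj I ((z : E) : F) - ((z : E) : F)‖ < δ s.length ∧ N < I.fst := by
  obtain ⟨y, I, hy, hI, hlim⟩ := hT.2.2 s hs
  obtain ⟨i, hi⟩ := (hlim.eventually_gt_atTop N).exists
  have hmem : y i ∈ {z : UnitSphere E | s ++ [z] ∈ T} := hy ▸ ⟨i, rfl⟩
  exact ⟨y i, I i, hmem, norm_sub_rev (hV.proj _ _) _ ▸ hI i, hi⟩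

theorem IsBlockTree.exists_branch_relDelta {hV : IsFDD V} {δ : ℕ → ℝ}
    {T : Set (List (UnitSphere E))} (hT : IsBlockTree hV δ T) {m : ℕ → ℕ} (hm : StrictMono m) :
    ∃ x ∈ branches T, RelDelta hV δ m x := by
  let bound (l : List (UnitSphere E × NonemptyInterval ℕ)) : ℕ :=
    l.getLast?.elim (m 0) fun b => m (b.2.snd + 2)
  obtain ⟨b, hb⟩ := exists_seq_of_forall_list
    (Good := fun l : List (UnitSphere E × NonemptyInterval ℕ) => l.map Prod.fst ∈ T)
    (P := fun l b => ‖hV.proj b.2 ((b.1 : E) : F) - ((b.1 : E) : F)‖ < δ l.length ∧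
      bound l < b.2.fst) hT.nil_mem fun l hl => by
        obtain ⟨z, I, hz, hzI, hI⟩ := hT.exists_child hl (bound l)
        exact ⟨(z, I), ⟨by simpa using hzI, hI⟩, by simpa using hz⟩
  have hlt : ∀ k, m ((b k).2.snd + 2) < (b (k + 1)).2.fst := fun k => by
    simpa [bound, map_range_succ] using (hb (k + 1)).2.2
  refine ⟨fun k => (b k).1, fun k => by simpa [Function.comp_def] using (hb k).1,
    fun k => (b k).2, ⟨fun k => ?_, fun k => by simpa using (hb k).2.1⟩, (hb 0).2.2,
    fun k => ⟨(b k).2.snd + 1, ?_, hm (Nat.lt_succ_self _), hlt k⟩⟩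
  · exact (Nat.le_add_right _ 2).trans_lt ((hm.le_apply).trans_lt (hlt k))
  · exact (Nat.lt_succ_self _).trans_le hm.le_apply

/-- A sequence of moves of player I against which `σ` answers with the vectors in `s`, whenever
each vector in `s` is a possible answer of `σ` after the moves chosen for the preceding ones. -/
noncomputable def StrategyII.history (σ : StrategyII E) (s : List (UnitSphere E)) : List ℕ :=
  s.foldl (fun l y => l ++ [Function.invFun (fun n => (σ (l ++ [n])).1) y]) []

/-- The tree of the sequences of vectors with which `σ` answers when player I plays according to
`StrategyII.history`. -/
def StrategyII.tree (σ : StrategyII E) : Set (List (UnitSphere E)) :=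
  {s | ∀ t y, t ++ [y] <+: s → ∃ n, (σ (σ.history t ++ [n])).1 = y}

theorem StrategyII.history_concat (σ : StrategyII E) (s : List (UnitSphere E))
    (y : UnitSphere E) : σ.history (s ++ [y]) =
      σ.history s ++ [Function.invFun (fun n => (σ (σ.history s ++ [n])).1) y] := by
  simp only [history, List.foldl_append, List.foldl_cons, List.foldl_nil]

theorem StrategyII.length_history (σ : StrategyII E) (s : List (UnitSphere E)) :
    (σ.history s).length = s.length := by
  induction s using List.reverseRecOn with
  | nil => rfl
  | append_singleton s y ih => simp [history_concat, ih]

theorem StrategyII.concat_mem_tree_iff {σ : StrategyII E} {s : List (UnitSphere E)}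
    (hs : s ∈ σ.tree) {y : UnitSphere E} :
    s ++ [y] ∈ σ.tree ↔ ∃ n, (σ (σ.history s ++ [n])).1 = y := by
  refine ⟨fun h => h s y List.prefix_rfl, fun h t z htz => ?_⟩
  obtain heq | hprefix := List.prefix_concat_iff.1 htz
  · obtain ⟨rfl, hzy⟩ := List.append_inj' heq rfl
    obtain rfl := List.singleton_injective hzy
    exact h
  · exact hs t z hprefix

theorem StrategyII.PlaysInto.rules {hV : IsFDD V} {δ : ℕ → ℝ} {σ : StrategyII E}
    {B : Set (ℕ → UnitSphere E)} (hσ : σ.PlaysInto hV δ B) (l : List ℕ) (n : ℕ) :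
    ‖((σ (l ++ [n])).1 : F) - hV.proj (σ (l ++ [n])).2 ((σ (l ++ [n])).1 : F)‖ < δ l.length ∧
      n < (σ (l ++ [n])).2.fst := by
  let ν : ℕ → ℕ := fun i => (l ++ [n]).getD i 0
  have hν : (List.range (l.length + 1)).map ν = l ++ [n] :=
    List.ext_getElem (by simp) fun i _ hi => by
      simp only [List.getElem_map, List.getElem_range, ν, List.getD_eq_getElem _ _ hi]
  have hlast : ν l.length = n := by simp [ν]
  have hproj := (hσ ν).1 l.length
  have hfst := (hσ ν).2.1 l.length
  rw [answer, hν] at hproj hfst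
  exact ⟨hproj, hlast ▸ hfst⟩

theorem StrategyII.PlaysInto.isBlockTree_tree {hV : IsFDD V} {δ : ℕ → ℝ} {σ : StrategyII E}
    {B : Set (ℕ → UnitSphere E)} (hσ : σ.PlaysInto hV δ B) : IsBlockTree hV δ σ.tree := by
  refine ⟨⟨[], fun t y h => by simp at h⟩, fun s hs t hts t' y h => hs t' y (h.trans hts),
    fun s hs => ⟨fun n => (σ (σ.history s ++ [n])).1, fun n => (σ (σ.history s ++ [n])).2,
      Set.ext fun z => concat_mem_tree_iff hs, fun n => ?_, ?_⟩⟩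
  · exact σ.length_history s ▸ (hσ.rules (σ.history s) n).1
  · exact tendsto_atTop_mono (fun n => (hσ.rules (σ.history s) n).2.le) tendsto_id

theorem StrategyII.PlaysInto.branches_tree_subset {hV : IsFDD V} {δ : ℕ → ℝ} {σ : StrategyII E}
    {B : Set (ℕ → UnitSphere E)} (hσ : σ.PlaysInto hV δ B) : branches σ.tree ⊆ B := by
  intro x hx
  have hmem : ∀ k, ∃ n, (σ (σ.history ((List.range k).map x) ++ [n])).1 = x k := fun k =>
    (concat_mem_tree_iff (hx k)).1 (map_range_succ x k ▸ hx (k + 1))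
  let ν : ℕ → ℕ := fun k =>
    Function.invFun (fun n => (σ (σ.history ((List.range k).map x) ++ [n])).1) (x k)
  have hν : ∀ k, σ.history ((List.range k).map x) = (List.range k).map ν := by
    intro k
    induction k with
    | zero => rfl
    | succ k ih => rw [map_range_succ, map_range_succ, ← ih, history_concat]
  have hanswer : (fun k => (σ.answer ν k).1) = x := funext fun k => by
    rw [answer, map_range_succ, ← hν]
    exact Function.invFun_eq (hmem k)
  exact hanswer ▸ (hσ ν).2.2.2

end Trees

section Nets

theorem exists_finite_net_of_dist_lt {ι X : Type*} [PseudoMetricSpace X] {f g : ι → X}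
    {S : Set ι} {η : ℝ} (hη : 0 < η) (hf : TotallyBounded (f '' S))
    (hfg : ∀ x ∈ S, dist (f x) (g x) < η) :
    ∃ D ⊆ S, D.Finite ∧ ∀ x ∈ S, ∃ y ∈ D, dist (g x) (g y) < 3 * η := by
  obtain ⟨D, hDS, hD, hcover⟩ := Set.exists_subset_image_finite_and.1
    (totallyBounded_iff_subset.1 hf _ (Metric.dist_mem_uniformity hη))
  refine ⟨D, hDS, hD, fun x hx => ?_⟩
  obtain ⟨_, ⟨y, hy, rfl⟩, hxy⟩ := Set.mem_iUnion₂.1 (hcover ⟨x, hx, rfl⟩)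
  refine ⟨y, hy, ?_⟩
  have hxy : dist (f x) (f y) < η := hxy
  have htriangle := dist_triangle4 (g x) (f x) (f y) (g y)
  linarith [hfg x hx, hfg y (hDS hy), dist_comm (f x) (g x)]

theorem totallyBounded_of_isBounded_of_subset {W : Submodule 𝕜 F} [FiniteDimensional 𝕜 W]
    {t : Set F} (ht : Bornology.IsBounded t) (htW : t ⊆ W) : TotallyBounded t := by
  have : ProperSpace W := FiniteDimensional.proper 𝕜 W
  obtain ⟨R, hR⟩ := ht.subset_closedBall 0
  refine ((isCompact_closedBall (0 : W) R).image continuous_subtype_val).totallyBounded.subset ?_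
  exact fun x hx => ⟨⟨x, htW hx⟩, by simpa using hR hx, rfl⟩

theorem IsFDD.proj_mem (hV : IsFDD V) (J : NonemptyInterval ℕ) (x : F) :
    hV.proj J x ∈ (Finset.Icc J.fst J.snd).sup V :=
  Submodule.sum_mem _ fun _ hi =>
    SetLike.le_def.1 (Finset.le_sup hi) ((hV.2 x).exists.choose_spec.1 _)

theorem IsFDD.exists_finite_net_sphere (hV : IsFDD V) (J : NonemptyInterval ℕ) {η : ℝ}
    (hη : 0 < η) :
    ∃ D : Set (UnitSphere E), D.Finite ∧
      (∀ y ∈ D, ‖hV.proj J ((y : E) : F) - ((y : E) : F)‖ < η) ∧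
      ∀ x : UnitSphere E, ‖hV.proj J ((x : E) : F) - ((x : E) : F)‖ < η →
        ∃ y ∈ D, ‖(x : E) - (y : E)‖ < 3 * η := by
  have hfin := hV.1
  have := Submodule.finiteDimensional_finset_sup (Finset.Icc J.fst J.snd) V
  let P : UnitSphere E → F := fun x => hV.proj J ((x : E) : F)
  let S : Set (UnitSphere E) := {x | ‖P x - ((x : E) : F)‖ < η}
  have hbounded : Bornology.IsBounded (P '' S) := by
    refine (Metric.isBounded_closedBall (x := (0 : F)) (r := 1 + η)).subset ?_
    rintro _ ⟨x, hx, rfl⟩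
    have hnorm : ‖((x : E) : F)‖ = 1 := norm_eq_of_mem_sphere x
    have htriangle := norm_le_norm_add_norm_sub' (P x) ((x : E) : F)
    have hx : ‖P x - ((x : E) : F)‖ < η := hx
    rw [mem_closedBall_zero_iff]
    linarith
  have htotal : TotallyBounded (P '' S) :=
    totallyBounded_of_isBounded_of_subset hbounded <| Set.image_subset_iff.2 fun _ _ =>
      hV.proj_mem J _
  obtain ⟨D, hDS, hD, hnet⟩ := exists_finite_net_of_dist_lt (f := P)
    (g := fun x => ((x : E) : F)) hη htotal fun x hx => (dist_eq_norm _ _).trans_lt hx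
  refine ⟨D, hD, fun y hy => hDS hy, fun x hx => ?_⟩
  obtain ⟨y, hy, hxy⟩ := hnet x hx
  exact ⟨y, hy, (dist_eq_norm ((x : E) : F) y).symm.trans_lt hxy⟩

theorem IsBlockWith.strictMono_snd {hV : IsFDD V} {δ : ℕ → ℝ} {x : ℕ → UnitSphere E}
    {I : ℕ → NonemptyInterval ℕ} (h : IsBlockWith hV δ x I) : StrictMono fun i => (I i).snd :=
  strictMono_nat_of_lt_succ fun i => (h.1 i).trans_le (I (i + 1)).fst_le_snd

theorem finite_setOf_snd_le (N : ℕ) : {J : NonemptyInterval ℕ | J.snd ≤ N}.Finite :=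
  ((Set.finite_Iic (N, N)).preimage NonemptyInterval.toProd_injective.injOn).subset
    fun J hJ => Prod.mk_le_mk.2 ⟨J.fst_le_snd.trans hJ, hJ⟩

theorem IsFDD.exists_finite_block_net (hV : IsFDD V) {η : ℕ → ℝ} (hη : ∀ i, 0 < η i) :
    ∃ S : ℕ → Set (UnitSphere E × NonemptyInterval ℕ), (∀ N, (S N).Finite) ∧
      ∀ (x : ℕ → UnitSphere E) I, IsBlockWith hV η x I → ∃ y, IsBlockWith hV η y I ∧
        (∀ i, ‖(x i : E) - (y i : E)‖ < 3 * η i) ∧ ∀ i N, (I i).snd ≤ N → (y i, I i) ∈ S N := by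
  choose D hDfin hDproj hDnet using fun (i : ℕ) (J : NonemptyInterval ℕ) =>
    hV.exists_finite_net_sphere (E := E) J (hη i)
  refine ⟨fun N => ⋃ i ∈ Set.Iic N, ⋃ J ∈ {J : NonemptyInterval ℕ | J.snd ≤ N}, D i J ×ˢ {J},
    fun N => ?_, fun x I hI => ?_⟩
  · exact (Set.finite_Iic N).biUnion fun i _ => (finite_setOf_snd_le N).biUnion fun J _ =>
      (hDfin i J).prod (Set.finite_singleton J)
  · choose y hyD hxy using fun i => hDnet i (I i) (x i) (hI.2 i)
    refine ⟨y, ⟨hI.1, fun i => hDproj _ _ _ (hyD i)⟩, hxy, fun i N hN => ?_⟩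
    simp only [Set.mem_iUnion]
    exact ⟨i, hI.strictMono_snd.le_apply.trans hN, I i, hN, hyD i, rfl⟩

end Nets

section BlockGame

/-- The rule for player II in the `Δ`-game: after the moves `l`, in answer to `n`, II may play the
pair `b` of a vector and an interval. -/
def blockRule (hV : IsFDD V) (δ : ℕ → ℝ) (l : List (UnitSphere E × NonemptyInterval ℕ)) (n : ℕ)
    (b : UnitSphere E × NonemptyInterval ℕ) : Prop :=
  ‖((b.1 : E) : F) - hV.proj b.2 ((b.1 : E) : F)‖ < δ l.length ∧ n < b.2.fst ∧
    ∀ c ∈ l.getLast?, c.2.snd < b.2.fst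

theorem IsWinningStrategy.playsInto {hV : IsFDD V} {δ : ℕ → ℝ} {σ : StrategyII E}
    {B : Set (ℕ → UnitSphere E)}
    (hσ : IsWinningStrategy (blockRule hV δ) {a | (fun k => (a k).1) ∈ B} σ) :
    σ.PlaysInto hV δ B := by
  intro n
  obtain ⟨hrule, hB⟩ := hσ n (σ.answer n) fun _ => rfl
  refine ⟨fun k => by simpa using (hrule k).1, fun k => (hrule k).2.1, fun k => ?_, hB⟩
  exact (hrule (k + 1)).2.2 _ (by simp [map_range_succ])

theorem DeltaPos.div_const {δ : ℕ → ℝ} (hδ : DeltaPos δ) {r : ℝ} (hr : 0 < r) :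
    DeltaPos fun i => δ i / r :=
  ⟨fun i => div_pos (hδ.1 i) hr, fun _ _ hij => div_le_div_of_nonneg_right (hδ.2.1 hij) hr.le,
    by simpa using hδ.2.2.div_const r⟩

theorem exists_playsInto_expansion_range {hV : IsFDD V} {δ : ℕ → ℝ} (hδ : ∀ i, 0 < δ i)
    {f : RecurrentBits → ℕ → UnitSphere E} (hf : Continuous f)
    (h : ∀ m : ℕ → ℕ, StrictMono m → ∃ x, RelDelta hV (fun i => δ i / 8) m x ∧
      x ∈ expansion (Set.range f) fun i => δ i / 8) :
    ∃ σ : StrategyII E, σ.PlaysInto hV δ (expansion (Set.range f) δ) := by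
  obtain ⟨S, hS, hnet⟩ := hV.exists_finite_block_net (E := E) (η := fun i => δ i / 8)
    fun i => div_pos (hδ i) (by norm_num)
  -- Passing from `x i` to the net costs at most `3 * (δ i / 8)`, so II stays within `δ i / 2`.
  let K (i : ℕ) (b : UnitSphere E × NonemptyInterval ℕ) : Set RecurrentBits :=
    {c | ‖(f c i : E) - (b.1 : E)‖ ≤ δ i / 2}
  have hK : ∀ i b, IsClosed (K i b) := fun i b => by
    have : Continuous fun c => (f c i : E) :=
      continuous_subtype_val.comp ((continuous_apply i).comp hf)
    exact isClosed_le (by fun_prop) continuous_const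
  suffices hσ : ∃ σ, IsWinningStrategy (blockRule hV δ) {a | (⋂ i, K i (a i)).Nonempty} σ by
    obtain ⟨σ, hσ⟩ := hσ
    refine ⟨σ, (hσ.mono fun a => ?_).playsInto⟩
    rintro ⟨c, hc⟩
    exact ⟨f c, ⟨c, rfl⟩, fun i => (Set.mem_iInter.1 hc i).trans_lt (half_lt_self (hδ i))⟩
  refine exists_isWinningStrategy_of_forall_strictMono hK hS fun m hm => ?_
  obtain ⟨x, ⟨I, hxI, hm0, hmI⟩, _, ⟨c, rfl⟩, hcx⟩ := h m hm
  obtain ⟨y, hyI, hxy, hyS⟩ := hnet x I hxI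
  have hproj : ∀ i, ‖((y i : E) : F) - hV.proj (I i) ((y i : E) : F)‖ < δ i := fun i =>
    (norm_sub_rev _ _).trans_lt ((hyI.2 i).trans (div_lt_self (hδ i) (by norm_num)))
  refine ⟨fun i => (y i, I i), ⟨c, Set.mem_iInter.2 fun i => ?_⟩,
    fun n hn => ⟨hproj 0, hn.trans_lt hm0, by simp⟩, fun k => ?_⟩
  · have htriangle := norm_sub_le_norm_sub_add_norm_sub (f c i : E) (x i : E) (y i : E)
    change ‖(f c i : E) - (y i : E)‖ ≤ δ i / 2
    linarith [hcx i, hxy i]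
  · obtain ⟨j, hIj, -, hjI⟩ := hmI k
    refine ⟨j, hxI.strictMono_snd.le_apply.trans_lt hIj, fun i hi =>
      hyS i _ ((hxI.strictMono_snd.monotone hi).trans hIj.le), fun n hn => ?_⟩
    exact ⟨by simpa using hproj (k + 1), hn.trans_lt hjI, by simp [map_range_succ, hxI.1 k]⟩

end BlockGame

end AsymptoticGame

open AsymptoticGame in
theorem mainTheorem6_general {𝕜 F : Type*} [RCLike 𝕜] [NormedAddCommGroup F] [NormedSpace 𝕜 F]
    (V : ℕ → Submodule 𝕜 F) (hV : IsFDD V) (E : Submodule 𝕜 F)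
    (A : Set (ℕ → UnitSphere E)) (hA : MeasureTheory.AnalyticSet A) :
    List.TFAE [
      ∀ δ : ℕ → ℝ, DeltaPos δ → ∀ m : ℕ → ℕ, StrictMono m →
        ∃ x : ℕ → UnitSphere E, RelDelta hV δ m x ∧ x ∈ expansion A δ,
      ∀ δ : ℕ → ℝ, DeltaPos δ →
        ∃ σ : StrategyII E, σ.PlaysInto hV δ (expansion A δ),
      ∀ δ : ℕ → ℝ, DeltaPos δ →
        ∃ T : Set (List (UnitSphere E)), IsBlockTree hV δ T ∧ branches T ⊆ expansion A δ] := by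
  tfae_have 1 → 2 := by
    intro h δ hδ
    obtain ⟨-, -, x, hx, -⟩ := h δ hδ id strictMono_id
    obtain ⟨f, hf, rfl⟩ := exists_continuous_recurrentBits_range_eq hA ⟨x, hx⟩
    exact exists_playsInto_expansion_range hδ.1 hf (h _ (hδ.div_const (by norm_num)))
  tfae_have 2 → 3 := by
    intro h δ hδ
    obtain ⟨σ, hσ⟩ := h δ hδ
    exact ⟨σ.tree, hσ.isBlockTree_tree, hσ.branches_tree_subset⟩
  tfae_have 3 → 1 := by
    intro h δ hδ m hm
    obtain ⟨T, hT, hTA⟩ := h δ hδ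
    obtain ⟨x, hx, hmx⟩ := hT.exists_branch_relDelta hm
    exact ⟨x, hmx, hTA hx⟩
  tfae_finish

theorem mainTheorem6 {𝕜 F : Type*} [RCLike 𝕜] [NormedAddCommGroup F] [NormedSpace 𝕜 F]
    [CompleteSpace F] (V : ℕ → Submodule 𝕜 F) (hV : AsymptoticGame.IsFDD V)
    (E : Submodule 𝕜 F) (hE : IsClosed (E : Set F))
    (A : Set (ℕ → AsymptoticGame.UnitSphere E)) (hA : MeasureTheory.AnalyticSet A) :
    List.TFAE [
      ∀ δ : ℕ → ℝ, AsymptoticGame.DeltaPos δ → ∀ m : ℕ → ℕ, StrictMono m →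
        ∃ x : ℕ → AsymptoticGame.UnitSphere E,
          AsymptoticGame.RelDelta hV δ m x ∧ x ∈ AsymptoticGame.expansion A δ,
      ∀ δ : ℕ → ℝ, AsymptoticGame.DeltaPos δ →
        ∃ σ : AsymptoticGame.StrategyII E,
          σ.PlaysInto hV δ (AsymptoticGame.expansion A δ),
      ∀ δ : ℕ → ℝ, AsymptoticGame.DeltaPos δ →
        ∃ T : Set (List (AsymptoticGame.UnitSphere E)),
          AsymptoticGame.IsBlockTree hV δ T ∧
            AsymptoticGame.branches T ⊆ AsymptoticGame.expansion A δ] :=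
  mainTheorem6_general V hV E A hA
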